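/- **Setting.** Consider $x[k+1]=Ax[k]$, $k\in\mathbb{N}$, with $A\in\mathbb{R}^{n\times n}$, and nodes $\mathcal V=\{1,\dots,N\}$ with measurements $y_i[k]=C_ix[k]$, $C_i\in\mathbb{R}^{r_i\times n}$. Let $C$ be the matrix obtained by stacking $C_1,\dots,C_N$, and suppose that $(A,C)$ is observable. A *multi-sensor form* of $(A,C_1,\dots,C_N)$ consists of dimensions $n_1,\dots,n_N\ge 0$ with $\sum_j n_j=n$ and an invertible matrix $P$ such that, in blocks of these sizes, $P^{-1}AP=(A_{jq})$ and $C_iP=(C_{i1},\dots,C_{iN})$ satisfy $A_{jq}=0$ and $C_{jq}=0$ for $q>j$, and each pair $(A_{jj},C_{jj})$ is observable. Write $x=Pz$ and let $z^{(j)}$ be the $j$-th block of $z$. At time $k$ the nodes communicate over a directed graph $\mathcal G[k]$ on $\mathcal V$; $\mathcal N_i[k]$ is the set of nodes $l\ne i$ with an edge $(l,i)$ in $\mathcal G[k]$. The sequence $(\mathcal G[k])$ is *jointly strongly connected with period* $T\ge 1$ if for every $k\in\mathbb{N}$ the union of the graphs $\mathcal G[t]$, $kT\le t<(k+1)T$,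 is strongly connected. **Algorithm (with gains $L_1,\dots,L_N$, $L_j\in\mathbb{R}^{n_j\times r_j}$).** Node $i$ keeps estimates $\hat z_i^{(j)}[k]$ of $z^{(j)}[k]$, with arbitrary initial values, and indices $\tau_i^{(j)}[k]\in\mathbb{N}\cup\{\omega\}$, with $\tau_j^{(j)}[k]=0$ for all $k$ and $\tau_i^{(j)}[0]=\omega$ for $i\ne j$. Node $j$ updates $$\hat z_j^{(j)}[k+1]=(A_{jj}-L_jC_{jj})\hat z_j^{(j)}[k]+\sum_{q<j}(A_{jq}-L_jC_{jq})\hat z_j^{(q)}[k]+L_jy_j[k].$$ For $i\neq j$ let $\mathcal M=\{l\in\mathcal N_i[k]:\tau_l^{(j)}[k]\ne\omega\}$, and let $S=\mathcal M$ if $\tau_i^{(j)}[k]=\omega$ and $S=\{l\in\mathcal M:\tau_l^{(j)}[k]<\tau_i^{(j)}[k]\}$ otherwise. If $S\ne\emptyset$, let $u$ be a minimizer of $\tau_l^{(j)}[k]$ over $l\in S$ (ties are broken arbitrarily), and if $S=\emptyset$ let $u=i$; then $$\tau_i^{(j)}[k+1]=\tau_u^{(j)}[k]+1\quad(\text{with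 }\omega+1=\omega),\qquad \hat z_i^{(j)}[k+1]=A_{jj}\hat z_u^{(j)}[k]+\sum_{q<j}A_{jq}\hat z_i^{(q)}[k].$$ The estimate of $x[k]$ by node $i$ is $\hat x_i[k]=P\hat z_i[k]$. **Claim.** A multi-sensor form exists. For every multi-sensor form there are gains $L_1,\dots,L_N$ such that every $A_{jj}-L_jC_{jj}$ is nilpotent. For any such gains, every sequence of graphs that is jointly strongly connected with some period $T\geq 1$, every trajectory $x$ of the system, and every run of the algorithm, $$\hat x_i[k]=x[k]\qquad\text{for all } i\in\mathcal V\text{ and all } k\ge n+2N(N-1)T .$$ -/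

import Mathlib

namespace DistributedObserver

/-- Observability of the pair `(A, C)` of the discrete-time system `x[k+1] = A x[k]`,
`y[k] = C x[k]`: the output sequence determines the initial state. -/
def Observable {ι κ : Type*} [Fintype ι] [DecidableEq ι]
    (A : Matrix ι ι ℝ) (C : Matrix κ ι ℝ) : Prop :=
  ∀ v w : ι → ℝ,
    (∀ k : ℕ, Matrix.mulVec C (Matrix.mulVec (A ^ k) v)
      = Matrix.mulVec C (Matrix.mulVec (A ^ k) w)) → v = w

/-- The collective observation matrix obtained by stacking `C₁, …, C_N`. -/
def stack {N n : ℕ} {r : Fin N → ℕ} (C : ∀ i, Matrix (Fin (r i)) (Fin n) ℝ) :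
    Matrix (Σ i, Fin (r i)) (Fin n) ℝ :=
  Matrix.of fun p => C p.1 p.2

/-! ### Communication graphs -/

/-- A directed graph is strongly connected if every vertex can be reached from every vertex
along a directed path. -/
def StronglyConnected {V : Type*} (G : Digraph V) : Prop :=
  ∀ u v : V, Relation.ReflTransGen G.Adj u v

/-- The union graph over the times in `[a, b)`. -/
def unionGraph {V : Type*} (G : ℕ → Digraph V) (a b : ℕ) : Digraph V where
  Adj u v := ∃ t, a ≤ t ∧ t < b ∧ (G t).Adj u v

/-- Joint strong connectivity with period `T`. -/
def JointlyStronglyConnected {V : Type*} (G : ℕ → Digraph V) (T : ℕ) : Prop :=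
  0 < T ∧ ∀ k : ℕ, StronglyConnected (unionGraph G (k * T) ((k + 1) * T))

/-- `neighbors G i` is the set of nodes other than `i` that can send information to `i`. -/
def neighbors {V : Type*} (G : Digraph V) (i : V) : Set V :=
  {l | l ≠ i ∧ G.Adj l i}

/-! ### The multi-sensor observable decomposition -/

/-- The matrix `Ā = P⁻¹ A P` of the system in the coordinates `x = P z`, where `Pinv` is the
inverse of `P`. The new coordinates are indexed by pairs (substate `j`, coordinate of the
`j`-th substate), so that `P` is a square matrix up to the naming of its columns. -/
def Abar {N n : ℕ} {d : Fin N → ℕ} (A : Matrix (Fin n) (Fin n) ℝ)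
    (P : Matrix (Fin n) (Σ j, Fin (d j)) ℝ) (Pinv : Matrix (Σ j, Fin (d j)) (Fin n) ℝ) :
    Matrix (Σ j, Fin (d j)) (Σ j, Fin (d j)) ℝ :=
  Pinv * A * P

/-- The block `A_{jq}` of `Ā`. -/
def Ablk {N n : ℕ} {d : Fin N → ℕ} (A : Matrix (Fin n) (Fin n) ℝ)
    (P : Matrix (Fin n) (Σ j, Fin (d j)) ℝ) (Pinv : Matrix (Σ j, Fin (d j)) (Fin n) ℝ)
    (j q : Fin N) : Matrix (Fin (d j)) (Fin (d q)) ℝ :=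
  (Abar A P Pinv).submatrix (fun a => ⟨j, a⟩) (fun b => ⟨q, b⟩)

/-- The block `C_{iq}` of `C̄_i = C_i P`. -/
def Cblk {N n : ℕ} {d r : Fin N → ℕ} (C : ∀ i, Matrix (Fin (r i)) (Fin n) ℝ)
    (P : Matrix (Fin n) (Σ j, Fin (d j)) ℝ) (i q : Fin N) :
    Matrix (Fin (r i)) (Fin (d q)) ℝ :=
  (C i * P).submatrix id (fun b => ⟨q, b⟩)

/-- `P` (with inverse `Pinv`) is a similarity transformation which puts `(A, C)` into the block
lower triangular multi-sensor form with observable diagonal pairs `(A_{jj}, C_{jj})`; `d j` is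
the dimension of the `j`-th substate (possibly zero). -/
structure IsMultisensorForm {N n : ℕ} {r : Fin N → ℕ} (A : Matrix (Fin n) (Fin n) ℝ)
    (C : ∀ i, Matrix (Fin (r i)) (Fin n) ℝ) (d : Fin N → ℕ)
    (P : Matrix (Fin n) (Σ j, Fin (d j)) ℝ)
    (Pinv : Matrix (Σ j, Fin (d j)) (Fin n) ℝ) : Prop where
  mul_inv : P * Pinv = 1
  inv_mul : Pinv * P = 1
  A_lower : ∀ j q : Fin N, j < q → Ablk A P Pinv j q = 0
  C_lower : ∀ i q : Fin N, i < q → Cblk C P i q = 0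
  observable : ∀ j : Fin N, Observable (Ablk A P Pinv j j) (Cblk C P j j)

/-- The gains `L` are deadbeat: each `A_{jj} - L_j C_{jj}` is nilpotent. -/
def Deadbeat {N n : ℕ} {d r : Fin N → ℕ} (A : Matrix (Fin n) (Fin n) ℝ)
    (C : ∀ i, Matrix (Fin (r i)) (Fin n) ℝ)
    (P : Matrix (Fin n) (Σ j, Fin (d j)) ℝ) (Pinv : Matrix (Σ j, Fin (d j)) (Fin n) ℝ)
    (L : ∀ j, Matrix (Fin (d j)) (Fin (r j)) ℝ) : Prop :=
  ∀ j, IsNilpotent (Ablk A P Pinv j j - L j * Cblk C P j j)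

/-! ### The algorithm -/

/-- `zhat k i j` is the estimate of the `j`-th substate by node `i` at time `k`. -/
abbrev Estimates {N : ℕ} (d : Fin N → ℕ) : Type :=
  ℕ → Fin N → (j : Fin N) → (Fin (d j) → ℝ)

/-- `τ k i j` is the freshness-index of node `i` for substate `j` at time `k`; the dummy value
`ω` (infinite delay) is `⊤`. -/
abbrev Indices (N : ℕ) : Type :=
  ℕ → Fin N → Fin N → ℕ∞

/-- The neighbors of `i` at time `k` whose index for substate `j` is not `ω`. -/
def setM {N : ℕ} (G : ℕ → Digraph (Fin N)) (τ : Indices N) (k : ℕ) (i j : Fin N) :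
    Set (Fin N) :=
  {l | l ∈ neighbors (G k) i ∧ τ k l j ≠ ⊤}

/-- The members of `setM` whose index for substate `j` is smaller than that of `i`. -/
def setF {N : ℕ} (G : ℕ → Digraph (Fin N)) (τ : Indices N) (k : ℕ) (i j : Fin N) :
    Set (Fin N) :=
  {l | l ∈ setM G τ k i j ∧ τ k l j < τ k i j}

/-- The source node `j` updates its estimate of substate `j` with its own measurement
`y_j = C_j x`. -/
def SourceUpdate {N n : ℕ} {d r : Fin N → ℕ} (A : Matrix (Fin n) (Fin n) ℝ)
    (C : ∀ i, Matrix (Fin (r i)) (Fin n) ℝ)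
    (P : Matrix (Fin n) (Σ j, Fin (d j)) ℝ) (Pinv : Matrix (Σ j, Fin (d j)) (Fin n) ℝ)
    (L : ∀ j, Matrix (Fin (d j)) (Fin (r j)) ℝ) (x : ℕ → Fin n → ℝ)
    (zhat : Estimates d) (k : ℕ) (j : Fin N) : Prop :=
  zhat (k + 1) j j =
    Matrix.mulVec (Ablk A P Pinv j j - L j * Cblk C P j j) (zhat k j j)
    + ∑ q ∈ Finset.Iio j,
        Matrix.mulVec (Ablk A P Pinv j q - L j * Cblk C P j q) (zhat k j q)
    + Matrix.mulVec (L j) (Matrix.mulVec (C j) (x k))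

/-- Node `i` updates its estimate of substate `j` from the estimate of substate `j` by node `u`
and its own estimates of the substates before `j`. Open-loop operation is the case `u = i`. -/
def CopyUpdate {N n : ℕ} {d : Fin N → ℕ} (A : Matrix (Fin n) (Fin n) ℝ)
    (P : Matrix (Fin n) (Σ j, Fin (d j)) ℝ) (Pinv : Matrix (Σ j, Fin (d j)) (Fin n) ℝ)
    (zhat : Estimates d) (k : ℕ) (i u j : Fin N) : Prop :=
  zhat (k + 1) i j =
    Matrix.mulVec (Ablk A P Pinv j j) (zhat k u j)
    + ∑ q ∈ Finset.Iio j, Matrix.mulVec (Ablk A P Pinv j q) (zhat k i q)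

/-- The update at time `k` of a non-source node `i` for substate `j` when `S` is its set of
informative neighbors: if `S` is non-empty it adopts the information of some (arbitrary)
minimizer `u` of the index over `S`, and otherwise it runs open-loop and its index is
incremented (`⊤ + 1 = ⊤`, so the index `ω` stays `ω`). -/
def InformedUpdate {N n : ℕ} {d : Fin N → ℕ} (A : Matrix (Fin n) (Fin n) ℝ)
    (P : Matrix (Fin n) (Σ j, Fin (d j)) ℝ) (Pinv : Matrix (Σ j, Fin (d j)) (Fin n) ℝ)
    (τ : Indices N) (zhat : Estimates d) (k : ℕ) (i j : Fin N) (S : Set (Fin N)) : Prop :=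
  (S.Nonempty → ∃ u ∈ S, (∀ l ∈ S, τ k u j ≤ τ k l j) ∧
      τ (k + 1) i j = τ k u j + 1 ∧ CopyUpdate A P Pinv zhat k i u j) ∧
  (S = ∅ → τ (k + 1) i j = τ k i j + 1 ∧ CopyUpdate A P Pinv zhat k i i j)

/-- `(τ, zhat)` is a run of the algorithm for the plant trajectory `x`, the graph sequence `G`
and the gains `L`. The initial estimates and the resolution of ties are arbitrary. -/
structure IsRun {N n : ℕ} {d r : Fin N → ℕ} (A : Matrix (Fin n) (Fin n) ℝ)
    (C : ∀ i, Matrix (Fin (r i)) (Fin n) ℝ)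
    (P : Matrix (Fin n) (Σ j, Fin (d j)) ℝ) (Pinv : Matrix (Σ j, Fin (d j)) (Fin n) ℝ)
    (L : ∀ j, Matrix (Fin (d j)) (Fin (r j)) ℝ) (G : ℕ → Digraph (Fin N))
    (x : ℕ → Fin n → ℝ) (τ : Indices N) (zhat : Estimates d) : Prop where
  init : ∀ i j : Fin N, i ≠ j → τ 0 i j = ⊤
  source_index : ∀ (k : ℕ) (j : Fin N), τ k j j = 0
  source_update : ∀ (k : ℕ) (j : Fin N), SourceUpdate A C P Pinv L x zhat k j
  untriggered : ∀ (k : ℕ) (i j : Fin N), i ≠ j → τ k i j = ⊤ →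
    InformedUpdate A P Pinv τ zhat k i j (setM G τ k i j)
  triggered : ∀ (k : ℕ) (i j : Fin N), i ≠ j → τ k i j ≠ ⊤ →
    InformedUpdate A P Pinv τ zhat k i j (setF G τ k i j)

/-- The estimate `x̂_i[k] = P ẑ_i[k]` of the plant state by node `i` at time `k`. -/
def xhat {N n : ℕ} {d : Fin N → ℕ} (P : Matrix (Fin n) (Σ j, Fin (d j)) ℝ)
    (zhat : Estimates d) (k : ℕ) (i : Fin N) : Fin n → ℝ :=
  Matrix.mulVec P fun p => zhat k i p.1 p.2

end DistributedObserver

/-! Let `W m` be the states invisible to the first `m` nodes: an `A`-invariant flag, decreasing to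
zero by observability. In a basis adapted to it, invariance makes `A` block lower triangular, and `C
i` kills `W q` for `q > i`. The `j`-th diagonal pair is the system induced on `W j / W (j+1)`; it is
observable because a vector of `W j` invisible to node `j` lies in `W (j+1)`.

For deadbeat gains, set `T 0 = ⊤` and `T (k+1) = A (T k ⊓ ker C)`. Observability forces this chain
to reach zero. A section `s` of `C` compatible with every `T k` gives the gain `L = A ∘ s`, and `A -
L C` then maps `T k` into `T (k+1)`.

Convergence is an induction on substates. Once the earlier ones are exact at all nodes, the source
error evolves by a nilpotent matrix of size `d j` and dies in `d j` steps. Copying sends error zero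
to error zero, and the index bounds the age of the information held: `err_eq_zero_of_index`.
Information reaches a new node in every period, so ages are at most `2 (N - 1) T` (`freshness_le`).
Substate `j` thus costs `d j + 2 (N - 1) T` steps; summing gives the bound. -/

namespace DistributedObserver

/-! ### Adapted bases and existence of the multi-sensor form -/

/-- A finite decreasing flag from the whole space to zero has an adapted basis. -/
theorem exists_basis_adapted_to_flag {K V : Type*} [Field K] [AddCommGroup V] [Module K V]
    [FiniteDimensional K V] {N : ℕ} (W : ℕ → Submodule K V) (hW : Antitone W) (h0 : W 0 = ⊤)
    (hN : W N = ⊥) :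
    ∃ (d : Fin N → ℕ) (b : Module.Basis (Σ j, Fin (d j)) K V),
      ∀ m, ∀ w, w ∈ W m ↔ ∀ p : Σ j, Fin (d j), (p.1 : ℕ) < m → b.repr w p = 0 := by
  have hex : ∀ j, ∃ U : Submodule K V, Disjoint (W (j + 1)) U ∧ W (j + 1) ⊔ U = W j :=
    fun j => IsModularLattice.exists_disjoint_and_sup_eq (hW (Nat.le_succ j))
  choose U hdisj hsup using hex
  let d : Fin N → ℕ := fun j => Module.finrank K (U j)
  let e : (Σ j, Fin (d j)) → V := fun p => (Module.finBasis K (U p.1) p.2 : V)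
  have hUW : ∀ j, U j ≤ W j := fun j => hsup j ▸ le_sup_right
  have hspan : ∀ m, m ≤ N → W m ≤ Submodule.span K (e '' {p | m ≤ p.1}) := by
    intro m hm
    induction hm using Nat.decreasingInduction with
    | self => simp [hN]
    | of_succ m hm ih =>
      rw [← hsup m]
      refine sup_le (ih.trans (Submodule.span_mono (Set.image_mono fun p hp => ?_)))
        fun u hu => ?_
      · exact (Nat.le_succ m).trans hp
      · have h1 := (Module.finBasis K (U m)).sum_repr ⟨u, hu⟩
        have h2 : _ = u := congrArg Subtype.val h1
        rw [← h2, AddSubmonoidClass.coe_finsetSum]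
        refine Submodule.sum_mem _ fun a _ => ?_
        exact Submodule.smul_mem _ _ (Submodule.subset_span ⟨⟨⟨m, hm⟩, a⟩, le_refl m, rfl⟩)
  -- The dimensions of the complements telescope along the flag, so the spanning family has the
  -- right size to be a basis.
  have hcard : Fintype.card (Σ j, Fin (d j)) = Module.finrank K V := by
    have h1 : ∀ m, ∑ j ∈ Finset.range m, Module.finrank K (U j) + Module.finrank K (W m)
        = Module.finrank K V := by
      intro m
      induction m with
      | zero => rw [h0, finrank_top, Finset.sum_range_zero, zero_add]
      | succ m ih =>
        have h2 := Submodule.finrank_sup_add_finrank_inf_eq (W (m + 1)) (U m)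
        rw [hsup m, (hdisj m).eq_bot, finrank_bot] at h2
        rw [Finset.sum_range_succ]
        omega
    have h3 := h1 N
    rw [hN, finrank_bot, add_zero, Finset.sum_range] at h3
    simpa [d] using h3
  let b : Module.Basis (Σ j, Fin (d j)) K V := basisOfTopLeSpanOfCardEqFinrank e
    (h0 ▸ (hspan 0 (Nat.zero_le N)).trans (Submodule.span_mono (Set.image_subset_range _ _)))
    hcard
  have hb : ∀ p, b p = e p := fun p => by simp [b]
  have hb' : (b : _ → V) = e := funext hb
  refine ⟨d, b, fun m w => ⟨fun hw p hp => ?_, fun hw => ?_⟩⟩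
  · by_cases hmN : m ≤ N
    · have h1 := hspan m hmN hw
      rw [← hb', Module.Basis.mem_span_image] at h1
      by_contra hne
      have h2 : m ≤ (p.1 : ℕ) := h1 (Finsupp.mem_support_iff.2 hne)
      omega
    · have h1 : w ∈ W N := hW (not_le.1 hmN).le hw
      rw [hN, Submodule.mem_bot] at h1
      simp [h1]
  · rw [← b.sum_repr w]
    refine Submodule.sum_mem _ fun p _ => ?_
    by_cases hp : (p.1 : ℕ) < m
    · rw [hw p hp, zero_smul]
      exact Submodule.zero_mem _
    · refine Submodule.smul_mem _ _ (hW (not_lt.1 hp) (hUW _ ?_))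
      rw [hb]
      exact Subtype.property _

/-- The states which the first `m` nodes cannot distinguish from zero. -/
def unobservableFlag {N n : ℕ} {r : Fin N → ℕ} (A : Matrix (Fin n) (Fin n) ℝ)
    (C : ∀ i, Matrix (Fin (r i)) (Fin n) ℝ) (m : ℕ) : Submodule ℝ (Fin n → ℝ) where
  carrier := {v | ∀ i : Fin N, (i : ℕ) < m → ∀ k : ℕ,
    Matrix.mulVec (C i) (Matrix.mulVec (A ^ k) v) = 0}
  zero_mem' := by simp
  add_mem' := fun ha hb i hi k => by
    rw [Matrix.mulVec_add, Matrix.mulVec_add, ha i hi k, hb i hi k, add_zero]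
  smul_mem' := fun c v hv i hi k => by
    rw [Matrix.mulVec_smul, Matrix.mulVec_smul, hv i hi k, smul_zero]

section UnobservableFlag

variable {N n : ℕ} {r : Fin N → ℕ} {A : Matrix (Fin n) (Fin n) ℝ}
    {C : ∀ i, Matrix (Fin (r i)) (Fin n) ℝ}

theorem unobservableFlag_antitone : Antitone (unobservableFlag A C) :=
  fun _ _ h _ hv i hi => hv i (hi.trans_le h)

theorem unobservableFlag_zero : unobservableFlag A C 0 = ⊤ :=
  (Submodule.eq_top_iff').2 fun _ _ hi => absurd hi (Nat.not_lt_zero _)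

theorem unobservableFlag_eq_bot (hobs : Observable A (stack C)) :
    unobservableFlag A C N = ⊥ := by
  refine (Submodule.eq_bot_iff _).2 fun v hv => hobs v 0 fun k => ?_
  rw [Matrix.mulVec_zero, Matrix.mulVec_zero]
  funext p
  exact congrFun (hv p.1 p.1.2 k) p.2

theorem mulVec_pow_mem_unobservableFlag {m : ℕ} {v : Fin n → ℝ}
    (hv : v ∈ unobservableFlag A C m) (l : ℕ) :
    Matrix.mulVec (A ^ l) v ∈ unobservableFlag A C m := fun i hi k => by
  rw [Matrix.mulVec_mulVec _ (A ^ k), ← pow_add]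
  exact hv i hi (k + l)

theorem mulVec_mem_unobservableFlag {m : ℕ} {v : Fin n → ℝ}
    (hv : v ∈ unobservableFlag A C m) : Matrix.mulVec A v ∈ unobservableFlag A C m := by
  simpa using mulVec_pow_mem_unobservableFlag hv 1

theorem mulVec_eq_zero_of_mem_unobservableFlag {m : ℕ} {v : Fin n → ℝ}
    (hv : v ∈ unobservableFlag A C m) {i : Fin N} (hi : (i : ℕ) < m) :
    Matrix.mulVec (C i) v = 0 := by
  simpa using hv i hi 0

/-- A basis adapted to the flag of unobservable subspaces gives a multi-sensor form. -/
theorem exists_isMultisensorForm (hobs : Observable A (stack C)) :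
    ∃ (d : Fin N → ℕ) (P : Matrix (Fin n) (Σ j, Fin (d j)) ℝ)
      (Pinv : Matrix (Σ j, Fin (d j)) (Fin n) ℝ), IsMultisensorForm A C d P Pinv := by
  obtain ⟨d, b, hb⟩ := exists_basis_adapted_to_flag (unobservableFlag A C)
    unobservableFlag_antitone unobservableFlag_zero (unobservableFlag_eq_bot hobs)
  set P := (Pi.basisFun ℝ (Fin n)).toMatrix b with hP
  set Q := b.toMatrix (Pi.basisFun ℝ (Fin n)) with hQ
  have hPQ : P * Q = 1 := Module.Basis.toMatrix_mul_toMatrix_flip _ _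
  have hQP : Q * P = 1 := Module.Basis.toMatrix_mul_toMatrix_flip _ _
  have hPcol : ∀ p, P.col p = b p := fun p => by
    ext a
    simp [hP, Module.Basis.toMatrix_apply]
  have hQv : ∀ v p, Matrix.mulVec Q v p = b.repr v p := fun v p => by
    have := congrFun (Module.Basis.toMatrix_mulVec_repr (Pi.basisFun ℝ (Fin n)) b v) p
    rw [← this]
    congr 1
  have hbmem : ∀ p : Σ j, Fin (d j), b p ∈ unobservableFlag A C p.1 := fun p =>
    (hb _ _).2 fun q hq => by
      rw [b.repr_self, Finsupp.single_apply, if_neg]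
      rintro rfl
      exact lt_irrefl _ hq
  have hmulcol : ∀ {l : ℕ} (B : Matrix (Fin l) (Fin n) ℝ) a p,
      (B * P) a p = Matrix.mulVec B (b p) a := fun B a p => by
    rw [← hPcol]; rfl
  have hA : ∀ p q, Abar A P Q p q = b.repr (Matrix.mulVec A (b q)) p := fun p q => by
    rw [← hQv, Matrix.mulVec_mulVec, ← hPcol]; rfl
  refine ⟨d, P, Q, hPQ, hQP, ?_, ?_, ?_⟩
  · intro j q hjq
    ext a c
    exact (hA _ _).trans ((hb q _).1 (mulVec_mem_unobservableFlag (hbmem ⟨q, c⟩)) ⟨j, a⟩ hjq)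
  · intro i q hiq
    ext a c
    refine (hmulcol (C i) a ⟨q, c⟩).trans ?_
    rw [mulVec_eq_zero_of_mem_unobservableFlag (hbmem ⟨q, c⟩) hiq]
    rfl
  · intro j
    -- `E` lifts `W j / W (j+1)`, in coordinates, back to `W j`. Modulo `W (j+1)` it intertwines the
    -- diagonal block with `A`.
    let E : (Fin (d j) → ℝ) → Fin n → ℝ := fun v => ∑ a, v a • b ⟨j, a⟩
    have hEmem : ∀ v, E v ∈ unobservableFlag A C j := fun v =>
      Submodule.sum_mem _ fun a _ => Submodule.smul_mem _ _ (hbmem ⟨j, a⟩)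
    have hErepr : ∀ v a, b.repr (E v) ⟨j, a⟩ = v a := fun v a => by
      simp [E, Finsupp.single_apply]
    have hErepr0 : ∀ v (p : Σ j, Fin (d j)), p.1 ≠ j → b.repr (E v) p = 0 := fun v p hp => by
      simp only [E, map_sum, map_smul, b.repr_self, Finsupp.coe_finsetSum, Finset.sum_apply,
        Finsupp.smul_apply, Finsupp.single_apply]
      refine Finset.sum_eq_zero fun a _ => ?_
      rw [if_neg, smul_zero]
      rintro rfl
      exact hp rfl
    have hEA : ∀ v, Matrix.mulVec A (E v) - E (Matrix.mulVec (Ablk A P Q j j) v)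
        ∈ unobservableFlag A C (j + 1) := fun v => (hb _ _).2 fun p hp => by
      rw [map_sub, Finsupp.sub_apply]
      rcases (Nat.lt_succ_iff.1 hp).lt_or_eq with hlt | heq
      · rw [(hb j _).1 (mulVec_mem_unobservableFlag (hEmem v)) p hlt,
          (hb j _).1 (hEmem _) p hlt, sub_zero]
      · obtain ⟨i, a⟩ := p
        obtain rfl : i = j := Fin.ext heq
        rw [hErepr, sub_eq_zero]
        simp only [E, Matrix.mulVec_sum, Matrix.mulVec_smul, map_sum, map_smul,
          Finsupp.coe_finsetSum, Finset.sum_apply, Finsupp.smul_apply, smul_eq_mul]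
        refine Finset.sum_congr rfl fun c _ => ?_
        rw [← hA, mul_comm]
        rfl
    have hEpow : ∀ v (k : ℕ), Matrix.mulVec (A ^ k) (E v)
        - E (Matrix.mulVec (Ablk A P Q j j ^ k) v) ∈ unobservableFlag A C (j + 1) := by
      intro v k
      induction k with
      | zero => simp
      | succ k ih =>
        have h1 := Submodule.add_mem _ (mulVec_mem_unobservableFlag ih)
          (hEA (Matrix.mulVec (Ablk A P Q j j ^ k) v))
        rw [Matrix.mulVec_sub, sub_add_sub_cancel, Matrix.mulVec_mulVec, Matrix.mulVec_mulVec,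
          ← pow_succ', ← pow_succ'] at h1
        exact h1
    have hEC : ∀ v, Matrix.mulVec (C j) (E v) = Matrix.mulVec (Cblk C P j j) v := fun v => by
      ext a
      simp only [E, Matrix.mulVec_sum, Matrix.mulVec_smul, Finset.sum_apply, Pi.smul_apply,
        smul_eq_mul, ← hmulcol]
      refine Finset.sum_congr rfl fun c _ => ?_
      rw [mul_comm]
      rfl
    intro v w hvw
    rw [← sub_eq_zero]
    set u := v - w with hu
    have hCu : ∀ k, Matrix.mulVec (Cblk C P j j) (Matrix.mulVec (Ablk A P Q j j ^ k) u) = 0 :=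
      fun k => by rw [hu, Matrix.mulVec_sub, Matrix.mulVec_sub, hvw k, sub_self]
    -- Since `C j` vanishes on `W (j+1)`, the error terms of `hEpow` are not seen by node `j`. So `E
    -- u` is invisible to node `j` too, and its `j`-th coordinates vanish.
    have hEu : E u ∈ unobservableFlag A C (j + 1) := fun i hi k => by
      rcases (Nat.lt_succ_iff.1 hi).lt_or_eq with hlt | heq
      · exact hEmem u i hlt k
      · obtain rfl : i = j := Fin.ext heq
        have h1 := mulVec_eq_zero_of_mem_unobservableFlag (hEpow u k) (Nat.lt_succ_self _)
        rwa [Matrix.mulVec_sub, hEC, hCu, sub_zero] at h1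
    funext a
    rw [← hErepr u a]
    exact (hb _ _).1 hEu ⟨j, a⟩ (Nat.lt_succ_self _)

end UnobservableFlag

/-! ### Deadbeat output injection for observable pairs -/

section OutputInjection

variable {K V W : Type*} [Field K] [AddCommGroup V] [Module K V] [AddCommGroup W] [Module K W]

/-- A linear map has a section on the image of a submodule with values in that submodule. -/
theorem exists_section_on_map (f : V →ₗ[K] W) (S : Submodule K V) :
    ∃ s : W →ₗ[K] V, ∀ y ∈ S.map f, s y ∈ S ∧ f (s y) = y := by
  obtain ⟨h, hh⟩ := (f.submoduleMap S).exists_rightInverse_of_surjective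
    (LinearMap.range_eq_top.2 (f.submoduleMap_surjective S))
  obtain ⟨s, hs⟩ := LinearMap.exists_extend (S.subtype ∘ₗ h)
  refine ⟨s, fun y hy => ?_⟩
  have h1 : s y = h ⟨y, hy⟩ := LinearMap.congr_fun hs ⟨y, hy⟩
  have h2 := congrArg Subtype.val (LinearMap.congr_fun hh ⟨y, hy⟩)
  rw [h1]
  exact ⟨(h ⟨y, hy⟩).2, h2⟩

/-- A linear map has a section that respects a given finite decreasing flag. -/
theorem exists_section_respecting_flag (f : V →ₗ[K] W) (T : ℕ → Submodule K V)
    (hT : Antitone T) {m : ℕ} (hm : T m = ⊥) :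
    ∃ s : W →ₗ[K] V, ∀ k, ∀ y ∈ (T k).map f, s y ∈ T k ∧ f (s y) = y := by
  suffices H : ∀ i, i ≤ m → ∃ s : W →ₗ[K] V, ∀ k, i ≤ k → ∀ y ∈ (T k).map f,
      s y ∈ T k ∧ f (s y) = y by
    obtain ⟨s, hs⟩ := H 0 (Nat.zero_le m)
    exact ⟨s, fun k => hs k (Nat.zero_le k)⟩
  intro i hi
  induction hi using Nat.decreasingInduction with
  | self =>
    refine ⟨0, fun k hk y hy => ?_⟩
    have : T k = ⊥ := le_bot_iff.1 (hm ▸ hT hk)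
    rw [this, Submodule.map_bot, Submodule.mem_bot] at hy
    simp [hy]
  | of_succ i hi ih =>
    obtain ⟨s, hs⟩ := ih
    obtain ⟨t, ht⟩ := exists_section_on_map f (T i)
    obtain ⟨p, hp⟩ := LinearMap.exists_extend (LinearMap.id : (T (i + 1)).map f →ₗ[K] _)
    have hpid : ∀ y ∈ (T (i + 1)).map f, (p y : W) = y := fun y hy =>
      congrArg Subtype.val (LinearMap.congr_fun hp ⟨y, hy⟩)
    have hle : T (i + 1) ≤ T i := hT (Nat.le_succ i)
    -- Use the old section on the part projected by `p` to the image of `T (i+1)`, and `t` on the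
    -- remainder. On that image `p` is the identity, so nothing changes at the levels beyond `i`.
    refine ⟨s ∘ₗ Submodule.subtype _ ∘ₗ p + t ∘ₗ (LinearMap.id - Submodule.subtype _ ∘ₗ p),
      fun k hk y hy => ?_⟩
    simp only [LinearMap.add_apply, LinearMap.comp_apply, Submodule.subtype_apply,
      LinearMap.sub_apply, LinearMap.id_apply]
    rcases hk.eq_or_lt with rfl | hk
    · have h1 := hs (i + 1) le_rfl _ (p y).2
      have h2 := ht (y - p y) (Submodule.sub_mem _ hy (Submodule.map_mono hle (p y).2))
      exact ⟨Submodule.add_mem _ (hle h1.1) h2.1, by rw [map_add, h1.2, h2.2]; abel⟩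
    · have hy' := Submodule.map_mono (hT hk) hy
      rw [hpid y hy', sub_self, map_zero, add_zero]
      exact hs k hk y hy

/-- The states that can be reached by trajectories of length `k` with zero output. -/
def silentReach (A : V →ₗ[K] V) (C : V →ₗ[K] W) : ℕ → Submodule K V
  | 0 => ⊤
  | k + 1 => (silentReach A C k ⊓ LinearMap.ker C).map A

theorem silentReach_antitone (A : V →ₗ[K] V) (C : V →ₗ[K] W) : Antitone (silentReach A C) := by
  refine antitone_nat_of_succ_le fun k => ?_
  induction k with
  | zero => exact le_top
  | succ k ih => exact Submodule.map_mono (inf_le_inf_right _ ih)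

/-- A stable member `S = A (S ⊓ ker C)` has dimension at most that of `S ⊓ ker C`, hence lies in
`ker C` and is `A`-invariant. Its orbits give zero output, so `S = 0`. Invertibility of `A` is not
needed. -/
theorem exists_silentReach_eq_bot [FiniteDimensional K V] (A : V →ₗ[K] V) (C : V →ₗ[K] W)
    (h : ∀ v, (∀ k, C ((A ^ k) v) = 0) → v = 0) : ∃ m, silentReach A C m = ⊥ := by
  obtain ⟨m, hm⟩ := IsArtinian.monotone_stabilizes
    (⟨silentReach A C, silentReach_antitone A C⟩ : ℕ →o (Submodule K V)ᵒᵈ)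
  have hm1 : silentReach A C m = (silentReach A C m ⊓ LinearMap.ker C).map A :=
    hm (m + 1) (Nat.le_succ m)
  have hker : silentReach A C m ≤ LinearMap.ker C := by
    have h1 : Module.finrank K (silentReach A C m) ≤
        Module.finrank K (silentReach A C m ⊓ LinearMap.ker C : Submodule K V) := by
      conv_lhs => rw [hm1]
      exact Submodule.finrank_map_le _ _
    exact inf_eq_left.1 (Submodule.eq_of_le_of_finrank_le inf_le_left h1)
  refine ⟨m, (Submodule.eq_bot_iff _).2 fun v hv => h v fun k => ?_⟩
  have : ∀ k, (A ^ k) v ∈ silentReach A C m := by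
    intro k
    induction k with
    | zero => exact hv
    | succ k ih =>
      rw [pow_succ', hm1]
      exact ⟨_, ⟨ih, hker ih⟩, rfl⟩
  exact hker (this k)

/-- An observable pair admits a deadbeat output injection. -/
theorem exists_isNilpotent_sub_comp [FiniteDimensional K V] (A : V →ₗ[K] V) (C : V →ₗ[K] W)
    (h : ∀ v, (∀ k, C ((A ^ k) v) = 0) → v = 0) :
    ∃ (L : W →ₗ[K] V) (m : ℕ), ∀ v, ((A - L ∘ₗ C) ^ m) v = 0 := by
  obtain ⟨m, hm⟩ := exists_silentReach_eq_bot A C h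
  obtain ⟨s, hs⟩ := exists_section_respecting_flag C _ (silentReach_antitone A C) hm
  -- The closed loop sends `w` to `A (w - s (C w))`, and for `w` in the `k`-th subspace the bracket
  -- stays there and lies in `ker C`.
  refine ⟨A ∘ₗ s, m, fun v => ?_⟩
  have : ∀ k, ((A - (A ∘ₗ s) ∘ₗ C) ^ k) v ∈ silentReach A C k := by
    intro k
    induction k with
    | zero => trivial
    | succ k ih =>
      rw [pow_succ', Module.End.mul_apply]
      set w := ((A - (A ∘ₗ s) ∘ₗ C) ^ k) v
      obtain ⟨h1, h2⟩ := hs k (C w) ⟨w, ih, rfl⟩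
      refine ⟨w - s (C w), ⟨Submodule.sub_mem _ ih h1, ?_⟩, by simp⟩
      simp [h2]
  simpa [hm] using this m

end OutputInjection

/-- An observable matrix pair admits a deadbeat gain. -/
theorem Observable.exists_isNilpotent_sub_mul {ι κ : Type*} [Fintype ι] [DecidableEq ι]
    [Fintype κ] [DecidableEq κ] {A : Matrix ι ι ℝ} {C : Matrix κ ι ℝ} (h : Observable A C) :
    ∃ L : Matrix ι κ ℝ, IsNilpotent (A - L * C) := by
  obtain ⟨L, m, hL⟩ := exists_isNilpotent_sub_comp (Matrix.toLin' A) (Matrix.toLin' C)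
    (fun v hv => h v 0 fun k => by
      have := hv k
      rw [← Matrix.toLin'_pow, Matrix.toLin'_apply, Matrix.toLin'_apply] at this
      rw [this, Matrix.mulVec_zero, Matrix.mulVec_zero])
  refine ⟨LinearMap.toMatrix' L, m, Matrix.toLin'.injective ?_⟩
  rw [Matrix.toLin'_pow, map_sub, Matrix.toLin'_mul, Matrix.toLin'_toMatrix', map_zero]
  exact LinearMap.ext hL

/-! ### Spread of information over jointly strongly connected graphs -/

section Flooding

variable {V : Type*}

/-- A set of informed vertices that does not grow over a period in which the union graph is
strongly connected contains all vertices. -/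
theorem mem_of_informed_subset {G : ℕ → Digraph V} {R : ℕ → Finset V} {a b : ℕ}
    (hG : StronglyConnected (unionGraph G a b))
    (hmono : ∀ t, a ≤ t → R t ⊆ R (t + 1))
    (hspread : ∀ t, a ≤ t → ∀ u v, u ∈ R t → (G t).Adj u v → v ∈ R (t + 1))
    (hsub : R b ⊆ R a) {j : V} (hj : j ∈ R a) (i : V) : i ∈ R a := by
  have hle : ∀ s t, a ≤ s → s ≤ t → R s ⊆ R t := fun s t hs hst => by
    induction t, hst using Nat.le_induction with
    | base => exact Finset.Subset.refl _
    | succ t hst ih => exact ih.trans (hmono t (hs.trans hst))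
  induction hG j i with
  | refl => exact hj
  | tail _ h ih =>
    obtain ⟨t, hat, htb, hadj⟩ := h
    exact hsub (hle (t + 1) b (by omega) htb (hspread t hat _ _ (hle a t le_rfl hat ih) hadj))

/-- Under joint strong connectivity, information held by one vertex at the beginning of a
period has reached at least `m + 1` vertices (or all of them) after `m` periods. -/
theorem min_card_le_card_informed [Fintype V] {G : ℕ → Digraph V} {T : ℕ}
    (hG : JointlyStronglyConnected G T) {R : ℕ → Finset V} {a : ℕ} {j : V}
    (hj : j ∈ R (a * T)) (hmono : ∀ t, a * T ≤ t → R t ⊆ R (t + 1))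
    (hspread : ∀ t, a * T ≤ t → ∀ u v, u ∈ R t → (G t).Adj u v → v ∈ R (t + 1)) (m : ℕ) :
    min (Fintype.card V) (m + 1) ≤ (R ((a + m) * T)).card := by
  have hle : ∀ s t, a * T ≤ s → s ≤ t → R s ⊆ R t := fun s t hs hst => by
    induction t, hst using Nat.le_induction with
    | base => exact Finset.Subset.refl _
    | succ t hst ih => exact ih.trans (hmono t (hs.trans hst))
  induction m with
  | zero => exact (min_le_right _ _).trans (Finset.card_pos.2 ⟨j, hj⟩)
  | succ m ih =>
    have h0 : a * T ≤ (a + m) * T := Nat.mul_le_mul_right T (Nat.le_add_right a m)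
    have h1 : (a + m) * T ≤ (a + (m + 1)) * T := Nat.mul_le_mul_right T (by omega)
    have hs := hle _ _ h0 h1
    -- Either the informed set gains a vertex during the period, or it is already everything.
    by_cases hsub : R ((a + (m + 1)) * T) ⊆ R ((a + m) * T)
    · have hall : R ((a + m) * T) = Finset.univ := Finset.eq_univ_iff_forall.2 <|
        mem_of_informed_subset (hG.2 (a + m)) (fun t ht => hmono t (h0.trans ht))
          (fun t ht => hspread t (h0.trans ht)) hsub (hle _ _ le_rfl h0 hj)
      rw [hall] at hs
      refine (min_le_left _ _).trans ?_
      rw [← Finset.card_univ]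
      exact Finset.card_le_card hs
    · have := Finset.card_lt_card (Finset.ssubset_iff_subset_ne.2
        ⟨hs, fun h => hsub h.ge⟩)
      omega

/-- If hop counts are propagated along the edges of a jointly strongly connected sequence of
graphs, then they are eventually bounded by `2 (N - 1) T`. -/
theorem freshness_le [Fintype V] {G : ℕ → Digraph V} {T : ℕ}
    (hG : JointlyStronglyConnected G T) {σ : ℕ → V → ℕ∞} {j : V} (hj : ∀ k, σ k j = 0)
    (hσ : ∀ k i, i ≠ j → ∀ l, l = i ∨ l ∈ neighbors (G k) i → σ (k + 1) i ≤ σ k l + 1)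
    (k : ℕ) (hk : (Fintype.card V - 1) * T ≤ k) (i : V) :
    σ k i ≤ (2 * (Fintype.card V - 1) * T : ℕ) := by
  classical
  obtain ⟨N, hN⟩ : ∃ N, Fintype.card V = N + 1 :=
    Nat.exists_eq_succ_of_ne_zero (Fintype.card_pos_iff.2 ⟨j⟩).ne'
  rw [hN, Nat.add_sub_cancel] at hk ⊢
  -- The single-vertex case is separate because the final estimate absorbs a partial period through
  -- `T ≤ N * T`.
  rcases Nat.eq_zero_or_pos N with rfl | hNpos
  · have := Fintype.card_le_one_iff_subsingleton.1 hN.le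
    rw [Subsingleton.elim i j, hj]
    exact zero_le
  have hT := hG.1
  have hkT : N ≤ k / T := (Nat.le_div_iff_mul_le hT).2 hk
  -- Start `N` full periods before the one containing `k`. The elapsed time `k - a * T` is then less
  -- than `(N + 1) * T`.
  obtain ⟨a, ha⟩ := Nat.exists_eq_add_of_le' hkT
  have hdm := Nat.div_add_mod' k T
  have hmod := Nat.mod_lt k hT
  rw [ha] at hdm
  -- The vertices whose hop count is small enough for information that left `j` no earlier than `a *
  -- T`.
  let R : ℕ → Finset V := fun t => {v | σ t v ≤ ((t - a * T : ℕ) : ℕ∞)}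
  have hmem : ∀ t v, v ∈ R t ↔ σ t v ≤ ((t - a * T : ℕ) : ℕ∞) := fun t v => by simp [R]
  have hstep : ∀ t, a * T ≤ t → ∀ u v, u ∈ R t → (u = v ∨ u ∈ neighbors (G t) v) →
      v ∈ R (t + 1) := by
    intro t ht u v hu huv
    rw [hmem] at hu ⊢
    by_cases hv : v = j
    · rw [hv, hj]
      exact zero_le
    · refine (hσ t v hv u huv).trans ?_
      rw [Nat.sub_add_comm ht, Nat.cast_add, Nat.cast_one]
      gcongr
  have hmono : ∀ t, a * T ≤ t → R t ⊆ R (t + 1) := fun t ht u hu =>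
    hstep t ht u u hu (Or.inl rfl)
  have hspread : ∀ t, a * T ≤ t → ∀ u v, u ∈ R t → (G t).Adj u v → v ∈ R (t + 1) :=
    fun t ht u v hu hadj => hstep t ht u v hu (or_iff_not_imp_left.2 fun h => ⟨h, hadj⟩)
  have hcard := min_card_le_card_informed hG (a := a) (R := R) (j := j)
    ((hmem _ _).2 (by rw [hj]; exact zero_le)) hmono hspread N
  rw [hN, min_self] at hcard
  have hall : ∀ t, (a + N) * T ≤ t → ∀ v, v ∈ R t := fun t ht => by
    induction t, ht using Nat.le_induction with
    | base =>
      exact fun v => (Finset.eq_univ_of_card _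
        (le_antisymm (Finset.card_le_univ _) (hN ▸ hcard))) ▸ Finset.mem_univ v
    | succ t ht ih =>
      exact fun v => hmono t ((Nat.mul_le_mul_right T (Nat.le_add_right a N)).trans ht) (ih v)
  refine ((hmem k i).1 (hall k (by omega) i)).trans (Nat.cast_le.2 ?_)
  have h1 : (a + N) * T = a * T + N * T := add_mul _ _ _
  have h2 : 2 * N * T = N * T + N * T := by ring
  have h3 : T ≤ N * T := Nat.le_mul_of_pos_left T hNpos
  omega

end Flooding

/-! ### Error dynamics and finite-time convergence -/

section Convergence

variable {N n : ℕ} {d r : Fin N → ℕ} {A : Matrix (Fin n) (Fin n) ℝ}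
  {C : ∀ i, Matrix (Fin (r i)) (Fin n) ℝ} {P : Matrix (Fin n) (Σ j, Fin (d j)) ℝ}
  {Pinv : Matrix (Σ j, Fin (d j)) (Fin n) ℝ} {L : ∀ j, Matrix (Fin (d j)) (Fin (r j)) ℝ}
  {G : ℕ → Digraph (Fin N)} {x : ℕ → Fin n → ℝ} {τ : Indices N} {zhat : Estimates d}

/-- A non-source node copies the estimate of a node `u` with a minimal index among itself and
its neighbors. -/
theorem IsRun.exists_copyUpdate (h : IsRun A C P Pinv L G x τ zhat) (k : ℕ) {i j : Fin N}
    (hij : i ≠ j) : ∃ u, τ (k + 1) i j = τ k u j + 1 ∧ CopyUpdate A P Pinv zhat k i u j ∧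
      ∀ l, l = i ∨ l ∈ neighbors (G k) i → τ k u j ≤ τ k l j := by
  by_cases hi : τ k i j = ⊤
  · have hu := h.untriggered k i j hij hi
    rcases (setM G τ k i j).eq_empty_or_nonempty with hS | hS
    · refine ⟨i, (hu.2 hS).1, (hu.2 hS).2, ?_⟩
      rintro l (rfl | hl)
      · exact le_rfl
      · have : τ k l j = ⊤ := by
          by_contra hne
          exact (Set.eq_empty_iff_forall_notMem.1 hS l) ⟨hl, hne⟩
        rw [this]
        exact le_top
    · obtain ⟨u, huS, hmin, h1, h2⟩ := hu.1 hS
      refine ⟨u, h1, h2, ?_⟩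
      rintro l (rfl | hl)
      · rw [hi]
        exact le_top
      · by_cases hlt : τ k l j = ⊤
        · rw [hlt]
          exact le_top
        · exact hmin l ⟨hl, hlt⟩
  · have hu := h.triggered k i j hij hi
    rcases (setF G τ k i j).eq_empty_or_nonempty with hS | hS
    · refine ⟨i, (hu.2 hS).1, (hu.2 hS).2, ?_⟩
      rintro l (rfl | hl)
      · exact le_rfl
      · by_contra hlt
        rw [not_le] at hlt
        exact (Set.eq_empty_iff_forall_notMem.1 hS l) ⟨⟨hl, hlt.ne_top⟩, hlt⟩
    · obtain ⟨u, huS, hmin, h1, h2⟩ := hu.1 hS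
      refine ⟨u, h1, h2, ?_⟩
      rintro l (rfl | hl)
      · exact huS.2.le
      · by_cases hlt : τ k l j < τ k i j
        · exact hmin l ⟨⟨hl, hlt.ne_top⟩, hlt⟩
        · exact huS.2.le.trans (not_lt.1 hlt)

/-- The freshness-indices of all nodes are bounded by `2 (N - 1) T` from time `2 (N - 1) T` on. -/
theorem IsRun.index_le (h : IsRun A C P Pinv L G x τ zhat) {T : ℕ}
    (hG : JointlyStronglyConnected G T) (k : ℕ) (hk : 2 * (N - 1) * T ≤ k) (i j : Fin N) :
    τ k i j ≤ (2 * (N - 1) * T : ℕ) := by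
  have h1 : (N - 1) * T ≤ 2 * (N - 1) * T := Nat.mul_le_mul_right T (by omega)
  have := freshness_le hG (σ := fun k i => τ k i j) (h.source_index · j)
    (fun k i hij l hl => by
      obtain ⟨u, hu, -, hmin⟩ := h.exists_copyUpdate k hij
      rw [hu]
      gcongr
      exact hmin l hl) k (by rw [Fintype.card_fin]; omega) i
  rwa [Fintype.card_fin] at this

/-- The `j`-th block of the state in the coordinates `x = P z`. -/
def substate (Pinv : Matrix (Σ j, Fin (d j)) (Fin n) ℝ) (v : Fin n → ℝ) (j : Fin N) :
    Fin (d j) → ℝ := fun a => Matrix.mulVec Pinv v ⟨j, a⟩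

theorem sum_eq_add_sum_Iio {M : Type*} [AddCommMonoid M] {f : Fin N → M} {j : Fin N}
    (hf : ∀ q, j < q → f q = 0) : ∑ q, f q = f j + ∑ q ∈ Finset.Iio j, f q := by
  rw [← Finset.sum_subset (Finset.subset_univ (Finset.Iic j)) fun q _ hq =>
    hf q (not_le.1 fun hle => hq (Finset.mem_Iic.2 hle)), ← Finset.Iio_insert,
    Finset.sum_insert (by simp)]

theorem IsMultisensorForm.mulVec_mulVec_inv (h : IsMultisensorForm A C d P Pinv)
    (v : Fin n → ℝ) : Matrix.mulVec P (Matrix.mulVec Pinv v) = v := by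
  rw [Matrix.mulVec_mulVec, h.mul_inv, Matrix.one_mulVec]

theorem IsMultisensorForm.substate_mulVec (h : IsMultisensorForm A C d P Pinv)
    (v : Fin n → ℝ) (j : Fin N) : substate Pinv (Matrix.mulVec A v) j =
      Matrix.mulVec (Ablk A P Pinv j j) (substate Pinv v j)
      + ∑ q ∈ Finset.Iio j, Matrix.mulVec (Ablk A P Pinv j q) (substate Pinv v q) := by
  rw [← sum_eq_add_sum_Iio (f := fun q => Matrix.mulVec (Ablk A P Pinv j q) (substate Pinv v q))
    fun q hq => by rw [h.A_lower j q hq, Matrix.zero_mulVec]]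
  have h1 : Matrix.mulVec Pinv (Matrix.mulVec A v)
      = Matrix.mulVec (Abar A P Pinv) (Matrix.mulVec Pinv v) := by
    conv_lhs => rw [← h.mulVec_mulVec_inv v]
    rw [Abar]
    simp only [Matrix.mulVec_mulVec, Matrix.mul_assoc]
  funext a
  rw [substate, h1, Finset.sum_apply]
  exact Fintype.sum_sigma _

theorem IsMultisensorForm.output_eq (h : IsMultisensorForm A C d P Pinv)
    (v : Fin n → ℝ) (j : Fin N) : Matrix.mulVec (C j) v =
      Matrix.mulVec (Cblk C P j j) (substate Pinv v j)
      + ∑ q ∈ Finset.Iio j, Matrix.mulVec (Cblk C P j q) (substate Pinv v q) := by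
  rw [← sum_eq_add_sum_Iio (f := fun q => Matrix.mulVec (Cblk C P j q) (substate Pinv v q))
    fun q hq => by rw [h.C_lower j q hq, Matrix.zero_mulVec]]
  conv_lhs => rw [← h.mulVec_mulVec_inv v]
  rw [Matrix.mulVec_mulVec]
  funext a
  rw [Finset.sum_apply]
  exact Fintype.sum_sigma _

theorem IsMultisensorForm.sum_dim (h : IsMultisensorForm A C d P Pinv) : ∑ j, d j = n := by
  have := Matrix.square_of_invertible P Pinv h.mul_inv h.inv_mul
  simpa using this.symm

/-- The estimation error of node `i` for the `j`-th substate. -/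
def err (Pinv : Matrix (Σ j, Fin (d j)) (Fin n) ℝ) (x : ℕ → Fin n → ℝ) (zhat : Estimates d)
    (k : ℕ) (i j : Fin N) : Fin (d j) → ℝ := zhat k i j - substate Pinv (x k) j

/-- With the earlier estimates of node `j` exact, their contributions to the predicted output cancel
against the measurement, leaving only `C_{jj}` times the error. -/
theorem err_source_succ (hF : IsMultisensorForm A C d P Pinv)
    (hx : ∀ k, x (k + 1) = Matrix.mulVec A (x k)) (h : IsRun A C P Pinv L G x τ zhat)
    (k : ℕ) (j : Fin N) (hq : ∀ q, q < j → err Pinv x zhat k j q = 0) :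
    err Pinv x zhat (k + 1) j j =
      Matrix.mulVec (Ablk A P Pinv j j - L j * Cblk C P j j) (err Pinv x zhat k j j) := by
  have h1 := h.source_update k j
  rw [SourceUpdate, hF.output_eq (x k) j, Finset.sum_congr rfl fun q hqj => by
    rw [sub_eq_zero.1 (hq q (Finset.mem_Iio.1 hqj))]] at h1
  rw [err, h1, hx, hF.substate_mulVec, err]
  simp only [Matrix.mulVec_sub, Matrix.sub_mulVec, Matrix.mulVec_add, Matrix.mulVec_sum,
    Matrix.mulVec_mulVec, Finset.sum_sub_distrib]
  abel

/-- The coupling terms use the estimates of the receiver `i`, so exactness of earlier substates is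
needed at `i`, not at `u`. -/
theorem err_copy_succ (hF : IsMultisensorForm A C d P Pinv)
    (hx : ∀ k, x (k + 1) = Matrix.mulVec A (x k)) {k : ℕ} {i u j : Fin N}
    (h : CopyUpdate A P Pinv zhat k i u j) (hq : ∀ q, q < j → err Pinv x zhat k i q = 0) :
    err Pinv x zhat (k + 1) i j =
      Matrix.mulVec (Ablk A P Pinv j j) (err Pinv x zhat k u j) := by
  rw [CopyUpdate, Finset.sum_congr rfl fun q hqj => by
    rw [sub_eq_zero.1 (hq q (Finset.mem_Iio.1 hqj))]] at h
  rw [err, h, hx, hF.substate_mulVec, err, Matrix.mulVec_sub]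
  abel

/-- The characteristic polynomial is `X ^ m`, so Cayley–Hamilton applies. The exponent `m` is what
makes the settling times of the sources add up to `n`. -/
theorem pow_eq_zero_of_isNilpotent {m : ℕ} {B : Matrix (Fin m) (Fin m) ℝ} (hB : IsNilpotent B) :
    B ^ m = 0 := by
  have hlin : IsNilpotent (Matrix.toLin' B) := hB.map (Matrix.toLinAlgEquiv' : _ ≃ₐ[ℝ] _)
  have h1 := (Matrix.toLin' B).aeval_self_charpoly
  rw [hlin.charpoly_eq_X_pow_finrank, map_pow, Polynomial.aeval_X, ← Matrix.toLin'_pow,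
    Module.finrank_fin_fun] at h1
  exact Matrix.toLin'.injective (by rw [h1, map_zero])

/-- The source node estimates its substate without error after `d j` steps without errors in
the preceding substates. -/
theorem err_source_eq_zero (hF : IsMultisensorForm A C d P Pinv)
    (hx : ∀ k, x (k + 1) = Matrix.mulVec A (x k)) (h : IsRun A C P Pinv L G x τ zhat)
    (hL : Deadbeat A C P Pinv L) {j : Fin N} {K : ℕ}
    (hq : ∀ k, K ≤ k → ∀ q, q < j → err Pinv x zhat k j q = 0) {k : ℕ} (hk : K + d j ≤ k) :
    err Pinv x zhat k j j = 0 := by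
  have hpow : ∀ m, err Pinv x zhat (K + m) j j =
      Matrix.mulVec ((Ablk A P Pinv j j - L j * Cblk C P j j) ^ m) (err Pinv x zhat K j j) := by
    intro m
    induction m with
    | zero => simp
    | succ m ih =>
      rw [← add_assoc, err_source_succ hF hx h _ j (hq _ (Nat.le_add_right K m)), ih,
        Matrix.mulVec_mulVec, ← pow_succ']
  obtain ⟨m, rfl⟩ := Nat.exists_eq_add_of_le hk
  rw [add_assoc, hpow, pow_add, pow_eq_zero_of_isNilpotent (hL j), zero_mul, Matrix.zero_mulVec]

/-- Error-free information of the source remains error-free while it travels. -/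
theorem err_eq_zero_of_index (hF : IsMultisensorForm A C d P Pinv)
    (hx : ∀ k, x (k + 1) = Matrix.mulVec A (x k)) (h : IsRun A C P Pinv L G x τ zhat)
    {j : Fin N} {K : ℕ} (hq : ∀ k, K ≤ k → ∀ i q, q < j → err Pinv x zhat k i q = 0)
    (hj : ∀ k, K ≤ k → err Pinv x zhat k j j = 0) (k : ℕ) (i : Fin N)
    (hk : τ k i j + K ≤ k) : err Pinv x zhat k i j = 0 := by
  induction k generalizing i with
  | zero =>
    by_cases hij : i = j
    · subst hij
      rw [h.source_index, zero_add] at hk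
      exact hj _ (Nat.cast_le.1 hk)
    -- A non-source index starts at `⊤`, so an arbitrary initial estimate never counts as fresh.
    · rw [h.init i j hij] at hk
      simp at hk
  | succ k ih =>
    by_cases hij : i = j
    · subst hij
      rw [h.source_index, zero_add] at hk
      exact hj _ (Nat.cast_le.1 hk)
    · obtain ⟨u, h1, h2, -⟩ := h.exists_copyUpdate k hij
      -- Index and estimate come from the same `u`, so one step back lowers both the index and the
      -- time by one.
      have hk' : τ k u j + K ≤ k := by
        rw [h1, add_right_comm, Nat.cast_add, Nat.cast_one] at hk
        exact (ENat.add_le_add_iff_right ENat.one_ne_top).1 hk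
      have hK : K ≤ k := Nat.cast_le.1 (le_add_self.trans hk')
      rw [err_copy_succ hF hx h2 (hq k hK i), ih u hk', Matrix.mulVec_zero]

/-- All nodes estimate the `j`-th substate without error after a finite time. -/
theorem err_eq_zero (hF : IsMultisensorForm A C d P Pinv)
    (hx : ∀ k, x (k + 1) = Matrix.mulVec A (x k)) (h : IsRun A C P Pinv L G x τ zhat)
    (hL : Deadbeat A C P Pinv L) {T : ℕ} (hG : JointlyStronglyConnected G T) (j : Fin N) :
    ∀ k, ∑ q ∈ Finset.Iic j, d q + (j + 1) * (2 * (N - 1) * T) ≤ k →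
      ∀ i, err Pinv x zhat k i j = 0 := by
  induction j using WellFoundedLT.induction with
  | ind j ih =>
    intro k hk i
    set D := 2 * (N - 1) * T with hD
    -- From time `K` on, every earlier substate is exact at every node; the source then needs `d j`
    -- steps and the spread of its information at most `D`.
    set K := ∑ q ∈ Finset.Iio j, d q + j * D with hKdef
    have hq : ∀ k, K ≤ k → ∀ i q, q < j → err Pinv x zhat k i q = 0 := by
      intro k hk i q hqj
      refine ih q hqj k (le_trans (Nat.add_le_add ?_ ?_) hk) i
      · exact Finset.sum_le_sum_of_subset fun p hp =>
          Finset.mem_Iio.2 ((Finset.mem_Iic.1 hp).trans_lt hqj)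
      · exact Nat.mul_le_mul_right D hqj
    have hsum : ∑ q ∈ Finset.Iic j, d q = d j + ∑ q ∈ Finset.Iio j, d q := by
      rw [← Finset.Iio_insert, Finset.sum_insert (by simp)]
    have hk' : D + (K + d j) ≤ k := by
      rw [hsum, add_mul, one_mul] at hk
      omega
    refine err_eq_zero_of_index hF hx h (K := K + d j) (fun k hk => hq k (by omega))
      (fun k hk => err_source_eq_zero hF hx h hL (fun k hk => hq k hk j) hk) k i ?_
    calc τ k i j + ((K + d j : ℕ) : ℕ∞) ≤ (D : ℕ) + ((K + d j : ℕ) : ℕ∞) := by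
          gcongr
          exact h.index_le hG k (by omega) i j
      _ ≤ k := by exact_mod_cast hk'

theorem xhat_sub_eq_zero (hF : IsMultisensorForm A C d P Pinv)
    (hx : ∀ k, x (k + 1) = Matrix.mulVec A (x k)) (h : IsRun A C P Pinv L G x τ zhat)
    (hL : Deadbeat A C P Pinv L) {T : ℕ} (hG : JointlyStronglyConnected G T) (i : Fin N)
    (k : ℕ) (hk : n + 2 * N * (N - 1) * T ≤ k) : xhat P zhat k i - x k = 0 := by
  have hz : (fun p : Σ j, Fin (d j) => zhat k i p.1 p.2) = Matrix.mulVec Pinv (x k) := by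
    funext ⟨j, a⟩
    refine congrFun (sub_eq_zero.1 (err_eq_zero hF hx h hL hG j k (le_trans ?_ hk) i)) a
    refine Nat.add_le_add ?_ ?_
    · rw [← hF.sum_dim]
      exact Finset.sum_le_sum_of_subset (Finset.subset_univ _)
    · calc (j + 1) * (2 * (N - 1) * T) ≤ N * (2 * (N - 1) * T) := Nat.mul_le_mul_right _ j.2
        _ = 2 * N * (N - 1) * T := by ring
  rw [xhat, hz, hF.mulVec_mulVec_inv, sub_self]

end Convergence

end DistributedObserver

theorem corollary1 {N n : ℕ} {r : Fin N → ℕ} (A : Matrix (Fin n) (Fin n) ℝ)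
    (C : ∀ i : Fin N, Matrix (Fin (r i)) (Fin n) ℝ)
    (hobs : DistributedObserver.Observable A (DistributedObserver.stack C)) :
    -- a coordinate transformation as used by the algorithm exists
    (∃ (d : Fin N → ℕ) (P : Matrix (Fin n) (Σ j, Fin (d j)) ℝ)
        (Pinv : Matrix (Σ j, Fin (d j)) (Fin n) ℝ),
        DistributedObserver.IsMultisensorForm A C d P Pinv) ∧
    -- for each of them deadbeat gains exist, and deadbeat gains give finite-time convergence
    ∀ (d : Fin N → ℕ) (P : Matrix (Fin n) (Σ j, Fin (d j)) ℝ)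
      (Pinv : Matrix (Σ j, Fin (d j)) (Fin n) ℝ),
      DistributedObserver.IsMultisensorForm A C d P Pinv →
      (∃ L : ∀ j, Matrix (Fin (d j)) (Fin (r j)) ℝ,
        DistributedObserver.Deadbeat A C P Pinv L) ∧
      ∀ L : ∀ j, Matrix (Fin (d j)) (Fin (r j)) ℝ,
        DistributedObserver.Deadbeat A C P Pinv L →
        ∀ (G : ℕ → Digraph (Fin N)) (T : ℕ),
          DistributedObserver.JointlyStronglyConnected G T →
          ∀ x : ℕ → Fin n → ℝ, (∀ k, x (k + 1) = Matrix.mulVec A (x k)) →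
          ∀ (τ : DistributedObserver.Indices N) (zhat : DistributedObserver.Estimates d),
            DistributedObserver.IsRun A C P Pinv L G x τ zhat →
            ∀ (i : Fin N) (k : ℕ), n + 2 * N * (N - 1) * T ≤ k →
              DistributedObserver.xhat P zhat k i - x k = 0 := by
  exact ⟨DistributedObserver.exists_isMultisensorForm hobs, fun d P Pinv hF =>
    ⟨⟨fun j => (hF.observable j).exists_isNilpotent_sub_mul.choose,
      fun j => (hF.observable j).exists_isNilpotent_sub_mul.choose_spec⟩,
    fun L hL G T hG x hx τ zhat h i k hk =>
      DistributedObserver.xhat_sub_eq_zero hF hx h hL hG i k hk⟩⟩
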